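/- Let $\mathbf{C}\{z_1\}$ be the ring of convergent power series, $K$ its field of fractions and $v$ the $z_1$-adic valuation on $K$ (normalized by $v(z_1)=1$); $v$ extends uniquely to a $\mathbf{Q}$-valued valuation on every finite extension of $K$. Let $U\subset \mathbf{C}\{z_1\}[z_2]$ be the multiplicative monoid of the polynomials that are monic in $z_2$ and not divisible by $z_2$, and let $W\subset U$ be the submonoid of Weierstrass polynomials, i.e. of those $f\in U$ with $f(0,z_2)=z_2^{n}$, where $n=\deg_{z_2} f$. For $f=\sum c_{ij}z_1^iz_2^j\in\mathbf{C}\{z_1\}[z_2]$, the Newton polygon $N(f)$ is (the boundary of) the convex hull in $\mathbf{R}^2$ of $\bigcup_{c_{ij}\ne 0}\big((i,j)+\mathbf{N}^2\big)$. In general a Newton polygon is (the boundary of) the convex hull of $S+\mathbf{N}^2$ for a set $S\subset\mathbf{N}^2$. The sum of two Newton polygons is the convex hull of the set of all sums $p_1+p_2$ of points $p_1,p_2$ of the two convex regions; its neutral element is the quadrant $\mathbf{R}_{\ge 0}^2$. Let $NU$ be the additive monoid of the Newton polygons whose regions meet both coordinate axes. For $f,g\in U$ write $f\sim g$ if for every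 $\rho\in\mathbf{Q}$ and every finite Galois extension $L$ of $K$ over which $f$ and $g$ split, $f$ and $g$ have the same number (with multiplicity) of roots in $L$ of valuation $\rho$. Write $f\sim_+ g$ if this holds for every $\rho>0$. Then: 1. $\sim$ is a congruence on $W$, and $f\mapsto N(f)$ induces an isomorphism of monoids $W/{\sim}\to NU$. 2. $\sim$ is a congruence on $U$, and $f\mapsto N(f)$ induces a surjective homomorphism of monoids $U/{\sim}\to NU$. 3. $\sim_+$ is a congruence on $U$, and $f\mapsto N(f)$ induces an isomorphism of monoids $U/{\sim_+}\to NU$. -/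

import Mathlib

open scoped Pointwise PowerSeries

noncomputable section

/-! ### Newton polygons in the plane -/

/-- The set of all real points `A + B`, where `A ∈ S` and `B ∈ ℕ²`. -/
def latticeShadow (S : Set (ℕ × ℕ)) : Set (ℝ × ℝ) :=
  {p | ∃ A ∈ S, ∃ B : ℕ × ℕ, p = (((A.1 + B.1 : ℕ) : ℝ), ((A.2 + B.2 : ℕ) : ℝ))}

/-- The convex region cut out by the exponent set `S ⊆ ℕ²`: the convex hull of `S + ℕ²` in `ℝ²`. -/
def newtonRegion (S : Set (ℕ × ℕ)) : Set (ℝ × ℝ) :=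
  convexHull ℝ (latticeShadow S)

theorem latticeShadow_add (S T : Set (ℕ × ℕ)) :
    latticeShadow S + latticeShadow T = latticeShadow (S + T) := by
  ext p
  constructor
  · rintro ⟨_, ⟨A, hA, B, rfl⟩, _, ⟨A', hA', B', rfl⟩, rfl⟩
    refine ⟨A + A', Set.add_mem_add hA hA', B + B', ?_⟩
    simp only [Prod.mk_add_mk, Prod.fst_add, Prod.snd_add]
    push_cast
    ext <;> simp only [] <;> ring
  · rintro ⟨_, ⟨A, hA, A', hA', rfl⟩, B, rfl⟩
    refine ⟨_, ⟨A, hA, B, rfl⟩, _, ⟨A', hA', 0, rfl⟩, ?_⟩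
    simp only [Prod.mk_add_mk, Prod.fst_add, Prod.snd_add, Prod.fst_zero, Prod.snd_zero]
    push_cast
    ext <;> simp only [] <;> ring

theorem newtonRegion_add (S T : Set (ℕ × ℕ)) :
    convexHull ℝ (newtonRegion S + newtonRegion T) = newtonRegion (S + T) := by
  unfold newtonRegion
  rw [← convexHull_add, ← latticeShadow_add]
  exact (convex_convexHull ℝ _).convexHull_eq

/-- A Newton polygon, given by the convex region that it bounds: the convex hull of `S + ℕ²`, where
`S ⊆ ℕ²` is arbitrary (every `S` is the support of a formal power series in two variables; the zero
series gives the empty region). The first coordinate is the exponent of `z₁`, the second one the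
exponent of `z₂`. -/
@[ext]
structure NewtonPolygon where
  region : Set (ℝ × ℝ)
  exists_support : ∃ S : Set (ℕ × ℕ), region = newtonRegion S

namespace NewtonPolygon

/-- The sum of two Newton polygons: the convex hull of the set of all sums `p₁ + p₂`. -/
instance : Add NewtonPolygon where
  add M N :=
    { region := convexHull ℝ (M.region + N.region)
      exists_support := by
        obtain ⟨S, hS⟩ := M.exists_support
        obtain ⟨T, hT⟩ := N.exists_support
        exact ⟨S + T, by rw [hS, hT, newtonRegion_add]⟩ }

/-- The neutral Newton polygon: its region is the whole positive quadrant. -/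
instance : Zero NewtonPolygon where
  zero := ⟨newtonRegion {0}, {0}, rfl⟩

theorem region_add (M N : NewtonPolygon) :
    (M + N).region = convexHull ℝ (M.region + N.region) := rfl

theorem region_zero : (0 : NewtonPolygon).region = newtonRegion {0} := rfl

protected theorem add_comm (M N : NewtonPolygon) : M + N = N + M := by
  ext1
  rw [region_add, region_add, add_comm]

protected theorem zero_add (N : NewtonPolygon) : 0 + N = N := by
  obtain ⟨S, hS⟩ := N.exists_support
  ext1
  rw [region_add, region_zero, hS, newtonRegion_add, Set.singleton_zero, zero_add]

protected theorem add_assoc (M N P : NewtonPolygon) : M + N + P = M + (N + P) := by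
  obtain ⟨S, hS⟩ := M.exists_support
  obtain ⟨T, hT⟩ := N.exists_support
  obtain ⟨R, hR⟩ := P.exists_support
  ext1
  simp only [region_add, hS, hT, hR, newtonRegion_add, add_assoc]

instance : AddCommMonoid NewtonPolygon where
  add_assoc := NewtonPolygon.add_assoc
  zero_add := NewtonPolygon.zero_add
  add_zero N := by rw [NewtonPolygon.add_comm, NewtonPolygon.zero_add]
  add_comm := NewtonPolygon.add_comm
  nsmul := nsmulRec

/-- The monoid `NU` of the Newton polygons that meet both coordinate axes. -/
def NU : AddSubmonoid NewtonPolygon where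
  carrier := {N | (∃ x : ℝ, (x, 0) ∈ N.region) ∧ ∃ y : ℝ, (0, y) ∈ N.region}
  zero_mem' := by
    have h : ((0 : ℝ), (0 : ℝ)) ∈ (0 : NewtonPolygon).region :=
      subset_convexHull ℝ _ ⟨0, rfl, 0, by simp⟩
    exact ⟨⟨0, h⟩, ⟨0, h⟩⟩
  add_mem' := by
    rintro M N ⟨⟨x, hx⟩, y, hy⟩ ⟨⟨x', hx'⟩, y', hy'⟩
    refine ⟨⟨x + x', subset_convexHull ℝ _ ⟨_, hx, _, hx', ?_⟩⟩,
      ⟨y + y', subset_convexHull ℝ _ ⟨_, hy, _, hy', ?_⟩⟩⟩ <;> simp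

end NewtonPolygon

/-! ### Convergent power series and polynomials over them -/

/-- The ring `ℂ{z₁}` of power series with a positive radius of convergence. -/
def ConvergentSeries : Subring ℂ⟦X⟧ where
  carrier := {f | ∃ r : ℝ, 0 < r ∧ Summable fun n : ℕ => ‖PowerSeries.coeff n f‖ * r ^ n}
  zero_mem' := ⟨1, one_pos, by simp⟩
  one_mem' := by
    refine ⟨1, one_pos, summable_of_ne_finset_zero (s := {0}) fun n hn => ?_⟩
    have hn' : n ≠ 0 := by simpa using hn
    simp [PowerSeries.coeff_one, hn']
  neg_mem' := by
    rintro f ⟨r, hr, hf⟩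
    exact ⟨r, hr, by simpa using hf⟩
  add_mem' := by
    rintro f g ⟨r, hr, hf⟩ ⟨s, hs, hg⟩
    have hm : 0 < min r s := lt_min hr hs
    refine ⟨min r s, hm, Summable.of_nonneg_of_le (fun n => by positivity) (fun n => ?_)
      (hf.add hg)⟩
    calc ‖PowerSeries.coeff n (f + g)‖ * min r s ^ n
        ≤ (‖PowerSeries.coeff n f‖ + ‖PowerSeries.coeff n g‖) * min r s ^ n := by
          rw [map_add]
          gcongr
          exact norm_add_le _ _
      _ = ‖PowerSeries.coeff n f‖ * min r s ^ n + ‖PowerSeries.coeff n g‖ * min r s ^ n := by ring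
      _ ≤ ‖PowerSeries.coeff n f‖ * r ^ n + ‖PowerSeries.coeff n g‖ * s ^ n := by
          gcongr
          · exact min_le_left _ _
          · exact min_le_right _ _
  mul_mem' := by
    rintro f g ⟨r, hr, hf⟩ ⟨s, hs, hg⟩
    have hm : 0 < min r s := lt_min hr hs
    set t := min r s with ht
    have hf' : Summable fun n : ℕ => ‖PowerSeries.coeff n f * (t : ℂ) ^ n‖ := by
      refine Summable.of_nonneg_of_le (fun n => norm_nonneg _) (fun n => ?_) hf
      rw [norm_mul, norm_pow, Complex.norm_of_nonneg hm.le]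
      gcongr
      exact min_le_left _ _
    have hg' : Summable fun n : ℕ => ‖PowerSeries.coeff n g * (t : ℂ) ^ n‖ := by
      refine Summable.of_nonneg_of_le (fun n => norm_nonneg _) (fun n => ?_) hg
      rw [norm_mul, norm_pow, Complex.norm_of_nonneg hm.le]
      gcongr
      exact min_le_right _ _
    refine ⟨t, hm, (summable_norm_sum_mul_antidiagonal_of_summable_norm hf' hg').congr
      fun n => ?_⟩
    have h : ∑ kl ∈ Finset.HasAntidiagonal.antidiagonal n, PowerSeries.coeff kl.1 f * (t : ℂ) ^ kl.1 *
        (PowerSeries.coeff kl.2 g * (t : ℂ) ^ kl.2) = PowerSeries.coeff n (f * g) * (t : ℂ) ^ n := by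
      rw [PowerSeries.coeff_mul, Finset.sum_mul]
      refine Finset.sum_congr rfl fun kl hkl => ?_
      rw [← Finset.HasAntidiagonal.mem_antidiagonal.1 hkl, pow_add]
      ring
    rw [h, norm_mul, norm_pow, Complex.norm_of_nonneg hm.le]

/-- The field of fractions `K` of `ℂ{z₁}`. -/
abbrev ConvergentSeriesField : Type := FractionRing ConvergentSeries

/-- The monoid `U` of the monic polynomials in `z₂` over `ℂ{z₁}` that are not divisible by `z₂`. -/
def monicU : Submonoid (Polynomial ConvergentSeries) where
  carrier := {f | f.Monic ∧ ¬ Polynomial.X ∣ f}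
  one_mem' := ⟨Polynomial.monic_one, by simp [Polynomial.X_dvd_iff]⟩
  mul_mem' := by
    rintro f g ⟨hf, hf'⟩ ⟨hg, hg'⟩
    exact ⟨hf.mul hg, fun h => (Polynomial.prime_X.dvd_or_dvd h).elim hf' hg'⟩

/-- The polynomial `f(0, z₂)`. -/
def atZero (f : Polynomial ConvergentSeries) : Polynomial ℂ :=
  f.map ((PowerSeries.constantCoeff (R := ℂ)).comp ConvergentSeries.subtype)

/-- The monoid of the Weierstrass polynomials in `U`, that is, those `f` of some degree `n` in `z₂`
with `f(0, z₂) = z₂ ^ n`. -/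
def weierstrassU : Submonoid (Polynomial ConvergentSeries) where
  carrier := {f | f ∈ monicU ∧ atZero f = Polynomial.X ^ f.natDegree}
  one_mem' := ⟨monicU.one_mem, by simp [atZero]⟩
  mul_mem' := by
    rintro f g ⟨hf, hf'⟩ ⟨hg, hg'⟩
    refine ⟨monicU.mul_mem hf hg, ?_⟩
    rw [hf.1.natDegree_mul hg.1, pow_add, ← hf', ← hg', atZero, Polynomial.map_mul, atZero, atZero]

/-- The Newton polygon `N(f)`: its region is the convex hull of `Supp(f) + ℕ²`, where `(i, j)` lies
in `Supp(f)` if the monomial `z₁ ^ i * z₂ ^ j` has a nonzero coefficient in `f`. -/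
def newtonPolygon (f : Polynomial ConvergentSeries) : NewtonPolygon where
  region := newtonRegion {A | PowerSeries.coeff A.1 (f.coeff A.2 : ℂ⟦X⟧) ≠ 0}
  exists_support := ⟨_, rfl⟩

/-! ### Valuations of roots -/

/-- The rational-valued valuation `w` of the extension field `L` of `K` extends the `z₁`-adic
valuation: `w` is the order of vanishing in `z₁` on `ℂ{z₁}` (hence on `K`). -/
def ExtendsAdic {L : Type} [Field L] [Algebra ConvergentSeriesField L]
    (w : AddValuation L (WithTop ℚ)) : Prop :=
  ∀ a : ConvergentSeries,
    w (algebraMap ConvergentSeriesField L (algebraMap ConvergentSeries ConvergentSeriesField a)) =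
      WithTop.map (Nat.cast : ℕ → ℚ) (PowerSeries.order (a : ℂ⟦X⟧))

/-- The polynomial `f`, seen as a polynomial in `z₂` over the extension field `L` of `K`. -/
def overField (L : Type) [Field L] [Algebra ConvergentSeriesField L]
    (f : Polynomial ConvergentSeries) : Polynomial L :=
  f.map ((algebraMap ConvergentSeriesField L).comp
    (algebraMap ConvergentSeries ConvergentSeriesField))

/-- The number `m_ρ` of roots of `f` in `L`, counted with multiplicity, whose valuation is `ρ`. -/
def rootCount {L : Type} [Field L] [Algebra ConvergentSeriesField L]
    (w : AddValuation L (WithTop ℚ)) (f : Polynomial ConvergentSeries) (ρ : ℚ) : ℕ :=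
  ((overField L f).roots.map w).count (ρ : WithTop ℚ)

/-- In every finite Galois extension `L` of `K` over which `f` and `g` split, with the extension of
the `z₁`-adic valuation to `L`, the polynomials `f` and `g` have the same number of roots of
valuation `ρ`. -/
def SameRootCount (f g : Polynomial ConvergentSeries) (ρ : ℚ) : Prop :=
  ∀ (L : Type) [Field L] [Algebra ConvergentSeriesField L]
    [FiniteDimensional ConvergentSeriesField L] [IsGalois ConvergentSeriesField L]
    (w : AddValuation L (WithTop ℚ)), ExtendsAdic w →
    (overField L f).Splits → (overField L g).Splits → rootCount w f ρ = rootCount w g ρ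

/-- The relation `f ∼ g`: the same number of roots of each valuation. -/
def RootEquiv (f g : Polynomial ConvergentSeries) : Prop :=
  ∀ ρ : ℚ, SameRootCount f g ρ

/-- The same number of roots of each positive valuation. -/
def PosRootEquiv (f g : Polynomial ConvergentSeries) : Prop :=
  ∀ ρ : ℚ, 0 < ρ → SameRootCount f g ρ

end

/-! Everything rests on the support function of `N(f)`: for rational `ρ`, the minimum of `i + ρ * j`
over the support of `f`. Over an extension `L` where `f` splits, this is the minimum over `j` of `w
(f_j) + ρ * j`, a Gauss-type valuation. Each root `α` contributes `min ρ (w α)` to it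
(`HasWeight.X_sub_C_mul`), so it equals the sum of `min ρ (w α)` over the roots
(`isLeast_weights_newtonSupport`).

By separation of convex sets, the values at `ρ > 0` determine the polygon
(`newtonRegion_eq_of_weights`). Conversely, the sum has a kink at `ρ` whose size is the number of
roots of valuation `ρ` (`sum_map_min_second_difference`). Hence `N(f) = N(g)` exactly when `f ∼₊ g`,
and additivity over roots gives `N(fg) = N(f) + N(g)`.

All roots have valuation at least `0`, and those of valuation `0` leave no trace for `ρ > 0`; thus
`∼` amounts to equality of polygon and degree. On Weierstrass polynomials the polygon already
determines the degree. Surjectivity comes from an explicit staircase polynomial. That a suitable `L`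
and `w` exist follows from `ℂ{z₁}` being a discrete valuation ring. -/

/-! ### Convergent power series form a discrete valuation ring. -/

namespace ConvergentSeries

/-- The variable `z₁` of `ℂ{z₁}`. -/
noncomputable def z : ConvergentSeries :=
  ⟨PowerSeries.X, 1, one_pos, summable_of_ne_finset_zero (s := {1}) fun n hn => by
    have hn' : n ≠ 1 := by simpa using hn
    simp [PowerSeries.coeff_X, hn']⟩

theorem coe_z : (z : ℂ⟦X⟧) = PowerSeries.X := rfl

/-- Without the constant term, shrinking the radius by a factor `t ≤ 1` shrinks the sum by at least
the same factor. -/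
theorem exists_small_tail {f : ℂ⟦X⟧} (hf : f ∈ ConvergentSeries) {c : ℝ} (hc : 0 < c) :
    ∃ r : ℝ, 0 < r ∧ (Summable fun n : ℕ => ‖PowerSeries.coeff (n + 1) f‖ * r ^ (n + 1)) ∧
      ∑' n : ℕ, ‖PowerSeries.coeff (n + 1) f‖ * r ^ (n + 1) ≤ c := by
  obtain ⟨r, hr, hs⟩ := hf
  have hs1 := (summable_nat_add_iff 1).2 hs
  set M := ∑' n : ℕ, ‖PowerSeries.coeff (n + 1) f‖ * r ^ (n + 1) with hM
  have hM0 : 0 ≤ M := tsum_nonneg fun n => by positivity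
  set t : ℝ := min 1 (c / (M + 1)) with ht
  have ht0 : 0 < t := lt_min one_pos (by positivity)
  have ht1 : t ≤ 1 := min_le_left _ _
  have hle : ∀ n : ℕ, ‖PowerSeries.coeff (n + 1) f‖ * (t * r) ^ (n + 1) ≤
      t * (‖PowerSeries.coeff (n + 1) f‖ * r ^ (n + 1)) := fun n => by
    have h1 : t ^ (n + 1) ≤ t := pow_le_of_le_one ht0.le ht1 (Nat.succ_ne_zero n)
    calc ‖PowerSeries.coeff (n + 1) f‖ * (t * r) ^ (n + 1)
        = t ^ (n + 1) * (‖PowerSeries.coeff (n + 1) f‖ * r ^ (n + 1)) := by ring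
      _ ≤ _ := by gcongr
  have hs2 := hs1.mul_left t
  have hs3 : Summable fun n : ℕ => ‖PowerSeries.coeff (n + 1) f‖ * (t * r) ^ (n + 1) :=
    Summable.of_nonneg_of_le (fun n => by positivity) hle hs2
  refine ⟨t * r, by positivity, hs3, ?_⟩
  calc _ ≤ ∑' n : ℕ, t * (‖PowerSeries.coeff (n + 1) f‖ * r ^ (n + 1)) :=
        hs3.tsum_le_tsum hle hs2
    _ = t * M := by rw [tsum_mul_left]
    _ ≤ c / (M + 1) * M := by gcongr; exact min_le_right _ _
    _ ≤ c / (M + 1) * (M + 1) := by gcongr; linarith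
    _ = c := by field_simp

/-- On a radius where the tail of `f` is at most `‖a‖`, the recursion for the coefficients of the
inverse bounds their terms by `‖a‖⁻¹`. Halving the radius turns boundedness into summability. -/
theorem inv_mem {f : ℂ⟦X⟧} (hf : f ∈ ConvergentSeries)
    (h0 : PowerSeries.constantCoeff f ≠ 0) : f⁻¹ ∈ ConvergentSeries := by
  set a := PowerSeries.constantCoeff f with ha
  have ha0 : 0 < ‖a‖ := norm_pos_iff.2 h0
  obtain ⟨r, hr, hs, hle⟩ := exists_small_tail hf ha0
  have hmul : f * f⁻¹ = 1 := PowerSeries.mul_inv_cancel f h0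
  have key : ∀ n : ℕ, ‖PowerSeries.coeff n f⁻¹‖ * r ^ n ≤ ‖a‖⁻¹ := by
    intro n
    induction n using Nat.strong_induction_on with
    | _ n ih =>
      rcases n with _ | n
      · simp [ha]
      · have h1 := congrArg (PowerSeries.coeff (n + 1)) hmul
        rw [PowerSeries.coeff_mul, Finset.Nat.sum_antidiagonal_eq_sum_range_succ_mk,
          Finset.sum_range_succ', PowerSeries.coeff_one, if_neg (Nat.succ_ne_zero n)] at h1
        simp only [Nat.sub_zero, PowerSeries.coeff_zero_eq_constantCoeff_apply] at h1
        have h2 : a * PowerSeries.coeff (n + 1) f⁻¹ = -∑ k ∈ Finset.range (n + 1),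
            PowerSeries.coeff (k + 1) f * PowerSeries.coeff (n + 1 - (k + 1)) f⁻¹ :=
          eq_neg_of_add_eq_zero_right h1
        have h3 : ‖a‖ * (‖PowerSeries.coeff (n + 1) f⁻¹‖ * r ^ (n + 1)) ≤ 1 := by
          rw [← mul_assoc, ← norm_mul, h2, norm_neg]
          calc _ ≤ (∑ k ∈ Finset.range (n + 1), ‖PowerSeries.coeff (k + 1) f‖ *
                ‖PowerSeries.coeff (n + 1 - (k + 1)) f⁻¹‖) * r ^ (n + 1) := by
                gcongr
                exact (norm_sum_le _ _).trans (by simp only [norm_mul, le_refl])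
            _ = ∑ k ∈ Finset.range (n + 1), (‖PowerSeries.coeff (k + 1) f‖ * r ^ (k + 1)) *
                (‖PowerSeries.coeff (n + 1 - (k + 1)) f⁻¹‖ * r ^ (n + 1 - (k + 1))) := by
                rw [Finset.sum_mul]
                refine Finset.sum_congr rfl fun k hk => ?_
                have hk' : k + 1 ≤ n + 1 := by simpa using hk
                have hp : r ^ (n + 1) = r ^ (k + 1) * r ^ (n + 1 - (k + 1)) := by
                  rw [← pow_add, Nat.add_sub_cancel' hk']
                rw [hp]
                ring
            _ ≤ ∑ k ∈ Finset.range (n + 1),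
                (‖PowerSeries.coeff (k + 1) f‖ * r ^ (k + 1)) * ‖a‖⁻¹ := by
                gcongr with k hk
                exact ih _ (by omega)
            _ = (∑ k ∈ Finset.range (n + 1), ‖PowerSeries.coeff (k + 1) f‖ * r ^ (k + 1)) *
                ‖a‖⁻¹ := by rw [Finset.sum_mul]
            _ ≤ ‖a‖ * ‖a‖⁻¹ := by
                gcongr
                exact (hs.sum_le_tsum _ fun i _ => by positivity).trans hle
            _ = 1 := mul_inv_cancel₀ ha0.ne'
        rwa [← le_div_iff₀' ha0, one_div] at h3
  refine ⟨r / 2, by positivity, Summable.of_nonneg_of_le (fun n => by positivity) (fun n => ?_)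
    ((summable_geometric_two).mul_left ‖a‖⁻¹)⟩
  calc ‖PowerSeries.coeff n f⁻¹‖ * (r / 2) ^ n
      = (‖PowerSeries.coeff n f⁻¹‖ * r ^ n) * (1 / 2) ^ n := by
        rw [div_pow, one_div, inv_pow]; ring
    _ ≤ _ := by gcongr; exact key n

theorem isUnit_iff {f : ConvergentSeries} :
    IsUnit f ↔ PowerSeries.constantCoeff (f : ℂ⟦X⟧) ≠ 0 := by
  constructor
  · intro h
    exact (h.map ((PowerSeries.constantCoeff (R := ℂ)).comp ConvergentSeries.subtype)).ne_zero
  · intro h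
    exact IsUnit.of_mul_eq_one ⟨_, inv_mem f.2 h⟩ (Subtype.ext (PowerSeries.mul_inv_cancel _ h))

theorem mem_of_X_mul_mem {f : ℂ⟦X⟧} (hf : PowerSeries.X * f ∈ ConvergentSeries) :
    f ∈ ConvergentSeries := by
  obtain ⟨r, hr, hs⟩ := hf
  refine ⟨r, hr, ?_⟩
  have h1 := ((summable_nat_add_iff 1).2 hs).mul_left r⁻¹
  refine h1.congr fun n => ?_
  rw [PowerSeries.coeff_succ_X_mul, pow_succ]
  field_simp

theorem mem_of_X_pow_mul_mem {f : ℂ⟦X⟧} (n : ℕ)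
    (hf : PowerSeries.X ^ n * f ∈ ConvergentSeries) : f ∈ ConvergentSeries := by
  induction n with
  | zero => simpa using hf
  | succ n ih => exact ih (mem_of_X_mul_mem (by rwa [pow_succ', mul_assoc] at hf))

theorem exists_eq_z_pow_mul {f : ConvergentSeries} (hf : f ≠ 0) :
    ∃ (n : ℕ) (u : ConvergentSeriesˣ), f = z ^ n * u ∧ PowerSeries.order (f : ℂ⟦X⟧) = n := by
  have hf' : (f : ℂ⟦X⟧) ≠ 0 := fun h => hf (Subtype.ext h)
  set n := (PowerSeries.order (f : ℂ⟦X⟧)).toNat with hn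
  have hn' : PowerSeries.order (f : ℂ⟦X⟧) = n :=
    (ENat.natCast_toNat (mt PowerSeries.order_eq_top.1 hf')).symm
  obtain ⟨g, hg⟩ := PowerSeries.X_pow_dvd_iff.2
    (fun m hm => PowerSeries.coeff_of_lt_order m (hn' ▸ (by exact_mod_cast hm)) :
      ∀ m < n, PowerSeries.coeff m (f : ℂ⟦X⟧) = 0)
  have hgm : g ∈ ConvergentSeries := mem_of_X_pow_mul_mem n (hg ▸ f.2)
  have hu : IsUnit (⟨g, hgm⟩ : ConvergentSeries) := by
    rw [isUnit_iff]
    have h := PowerSeries.coeff_order hf'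
    rw [← hn, hg] at h
    have h' := PowerSeries.coeff_X_pow_mul g n 0
    rw [zero_add] at h'
    rwa [h', PowerSeries.coeff_zero_eq_constantCoeff_apply] at h
  obtain ⟨u, hu⟩ := hu
  refine ⟨n, u, Subtype.ext ?_, hn'⟩
  rw [hu]
  exact hg

theorem irreducible_z : Irreducible z := by
  have hz : ¬ IsUnit z := by rw [isUnit_iff, coe_z]; simp
  refine ⟨hz, fun a b hab => ?_⟩
  have h1 := PowerSeries.X_irreducible (R := ℂ)
  have h2 : (PowerSeries.X : ℂ⟦X⟧) = (a : ℂ⟦X⟧) * (b : ℂ⟦X⟧) := congrArg Subtype.val hab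
  have key : ∀ c : ConvergentSeries, IsUnit (c : ℂ⟦X⟧) → IsUnit c := fun c hc =>
    isUnit_iff.2 (PowerSeries.isUnit_iff_constantCoeff.1 hc).ne_zero
  exact (h1.isUnit_or_isUnit h2).imp (key a) (key b)

instance : IsDiscreteValuationRing ConvergentSeries :=
  IsDiscreteValuationRing.ofHasUnitMulPowIrreducibleFactorization
    ⟨z, irreducible_z, fun {x} hx => by
      obtain ⟨n, u, h, -⟩ := exists_eq_z_pow_mul hx
      exact ⟨n, u, h.symm⟩⟩

/-- Characteristic zero supplies the separability of the splitting fields used below. -/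
instance : CharZero ConvergentSeries where
  cast_injective m n h := by
    have h1 := congrArg ((PowerSeries.constantCoeff (R := ℂ)).comp ConvergentSeries.subtype) h
    simpa only [map_natCast, Nat.cast_inj] using h1

instance : CharZero ConvergentSeriesField :=
  charZero_of_injective_algebraMap (IsFractionRing.injective ConvergentSeries _)

end ConvergentSeries

/-! ### Extending the valuation to a splitting field. -/

/-- A `ℤᵐ⁰`-valued valuation, written additively and divided by the positive integer `e`. -/
noncomputable def Valuation.toAddValuationDiv {L : Type*} [Field L]
    (v : Valuation L (WithZero (Multiplicative ℤ))) (e : ℕ) (he : 0 < e) :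
    AddValuation L (WithTop ℚ) := by
  classical
  have he' : (0 : ℚ) < e := by exact_mod_cast he
  refine AddValuation.of
    (fun x => if x = 0 then ⊤ else ((-(WithZero.log (v x) : ℤ) / e : ℚ) : WithTop ℚ))
    (by simp) (by simp) ?_ ?_
  · intro x y
    by_cases hx : x = 0
    · simp [hx]
    by_cases hy : y = 0
    · simp [hy]
    by_cases hxy : x + y = 0
    · simp [hxy]
    have hx' : v x ≠ 0 := (map_ne_zero v).2 hx
    have hy' : v y ≠ 0 := (map_ne_zero v).2 hy
    have hxy' : v (x + y) ≠ 0 := (map_ne_zero v).2 hxy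
    simp only [hx, hy, hxy, if_false]
    rcases le_max_iff.1 (v.map_add x y) with h | h
    · refine min_le_iff.2 (Or.inl ?_)
      have h' := (WithZero.log_le_log hxy' hx').2 h
      have h'' : ((WithZero.log (v (x + y)) : ℤ) : ℚ) ≤ (WithZero.log (v x) : ℤ) := by
        exact_mod_cast h'
      exact WithTop.coe_le_coe.2 (div_le_div_of_nonneg_right (neg_le_neg h'') he'.le)
    · refine min_le_iff.2 (Or.inr ?_)
      have h' := (WithZero.log_le_log hxy' hy').2 h
      have h'' : ((WithZero.log (v (x + y)) : ℤ) : ℚ) ≤ (WithZero.log (v y) : ℤ) := by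
        exact_mod_cast h'
      exact WithTop.coe_le_coe.2 (div_le_div_of_nonneg_right (neg_le_neg h'') he'.le)
  · intro x y
    by_cases hx : x = 0
    · simp [hx]
    by_cases hy : y = 0
    · simp [hy]
    have hx' : v x ≠ 0 := (map_ne_zero v).2 hx
    have hy' : v y ≠ 0 := (map_ne_zero v).2 hy
    simp only [hx, hy, mul_eq_zero, or_self, if_false, map_mul, WithZero.log_mul hx' hy']
    rw [← WithTop.coe_add, WithTop.coe_inj]
    push_cast
    ring

theorem Valuation.toAddValuationDiv_apply {L : Type*} [Field L]
    (v : Valuation L (WithZero (Multiplicative ℤ))) (e : ℕ) (he : 0 < e) {x : L} (hx : x ≠ 0) :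
    v.toAddValuationDiv e he x = ((-(WithZero.log (v x) : ℤ) / e : ℚ) : WithTop ℚ) := by
  simp [Valuation.toAddValuationDiv, hx]

/-- The valuation of a discrete valuation ring extends to every finite separable extension of its
field of fractions. -/
theorem IsDiscreteValuationRing.exists_addValuation_extension (A K L : Type*) [CommRing A]
    [IsDomain A] [IsDiscreteValuationRing A] [Field K] [Algebra A K] [IsFractionRing A K] [Field L]
    [Algebra K L] [Algebra A L] [IsScalarTower A K L] [FiniteDimensional K L]
    [Algebra.IsSeparable K L] {ϖ : A} (hϖ : Irreducible ϖ) :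
    ∃ w : AddValuation L (WithTop ℚ), ∀ (n : ℕ) (u : Aˣ),
      w (algebraMap A L (ϖ ^ n * u)) = ((n : ℚ) : WithTop ℚ) := by
  let B := integralClosure A L
  have : IsDedekindDomain B := integralClosure.isDedekindDomain A K L
  have : IsFractionRing B L := integralClosure.isFractionRing_of_finite_extension K L
  have hinjL : Function.Injective (algebraMap A L) := by
    rw [IsScalarTower.algebraMap_eq A K L]
    exact (algebraMap K L).injective.comp (IsFractionRing.injective A K)
  have hinj : Function.Injective (algebraMap A B) := by
    refine Function.Injective.of_comp (f := algebraMap B L) ?_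
    rw [← RingHom.coe_comp, ← IsScalarTower.algebraMap_eq A B L]
    exact hinjL
  -- An integral extension creates no new units, so some maximal ideal of `B` lies over `ϖ`.
  have hnu : ¬ IsUnit (algebraMap A B ϖ) := fun h =>
    hϖ.not_isUnit (((algebraMap_isIntegral_iff.2 inferInstance).isLocalHom hinj).map_nonunit _ h)
  obtain ⟨P, hP, hϖP⟩ := exists_max_ideal_of_mem_nonunits hnu
  have hϖ0 : algebraMap A B ϖ ≠ 0 := (map_ne_zero_iff _ hinj).2 hϖ.ne_zero
  let 𝔭 : IsDedekindDomain.HeightOneSpectrum B :=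
    ⟨P, hP.isPrime, fun h => hϖ0 (by rw [h] at hϖP; exact hϖP)⟩
  let v := 𝔭.valuation L
  have hϖL : algebraMap A L ϖ ≠ 0 := (map_ne_zero_iff _ hinjL).2 hϖ.ne_zero
  have hv0 : v (algebraMap A L ϖ) ≠ 0 := (map_ne_zero v).2 hϖL
  have hv1 : v (algebraMap A L ϖ) < 1 := by
    rw [IsScalarTower.algebraMap_apply A B L]
    exact (𝔭.valuation_lt_one_iff_mem _).2 hϖP
  have hlog : WithZero.log (v (algebraMap A L ϖ)) < 0 := by
    have := (WithZero.log_lt_log hv0 one_ne_zero).2 hv1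
    rwa [WithZero.log_one] at this
  -- `e` is the ramification index of `𝔭`; dividing by it normalizes the value of `ϖ` to `1`.
  obtain ⟨e, he⟩ := Int.eq_ofNat_of_zero_le (a := -WithZero.log (v (algebraMap A L ϖ))) (by omega)
  have he0 : 0 < e := by omega
  refine ⟨v.toAddValuationDiv e he0, fun n u => ?_⟩
  have hle : ∀ a : A, v (algebraMap A L a) ≤ 1 := fun a => by
    rw [IsScalarTower.algebraMap_apply A B L]
    exact 𝔭.valuation_le_one _
  have hu : v (algebraMap A L u) = 1 := by
    refine le_antisymm (hle _) ?_
    have h1 : v (algebraMap A L u) * v (algebraMap A L (u⁻¹ : Aˣ)) = 1 := by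
      rw [← map_mul, ← map_mul, Units.mul_inv, map_one, map_one]
    calc (1 : WithZero (Multiplicative ℤ))
        = v (algebraMap A L u) * v (algebraMap A L (u⁻¹ : Aˣ)) := h1.symm
      _ ≤ v (algebraMap A L u) * 1 := by gcongr; exact hle _
      _ = _ := mul_one _
  have hne : algebraMap A L (ϖ ^ n * u) ≠ 0 :=
    (map_ne_zero_iff _ hinjL).2 (mul_ne_zero (pow_ne_zero _ hϖ.ne_zero) u.ne_zero)
  rw [Valuation.toAddValuationDiv_apply _ _ _ hne, map_mul, map_mul, hu, mul_one, map_pow, map_pow,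
    WithZero.log_pow, WithTop.coe_inj]
  have he' : (e : ℚ) = -((WithZero.log (v (algebraMap A L ϖ)) : ℤ) : ℚ) := by exact_mod_cast he.symm
  have he'' : (e : ℚ) ≠ 0 := by exact_mod_cast he0.ne'
  rw [div_eq_iff he'', he', nsmul_eq_mul]
  push_cast
  ring

/-- Every polynomial over `ℂ{z₁}` splits in a finite Galois extension of `K` to which the
`z₁`-adic valuation extends. -/
theorem exists_splitting_extension (f : Polynomial ConvergentSeries) :
    ∃ (L : Type) (_ : Field L) (_ : Algebra ConvergentSeriesField L)
      (_ : FiniteDimensional ConvergentSeriesField L) (_ : IsGalois ConvergentSeriesField L)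
      (w : AddValuation L (WithTop ℚ)), ExtendsAdic w ∧ (overField L f).Splits := by
  let p : Polynomial ConvergentSeriesField := f.map (algebraMap _ _)
  have hn : Normal ConvergentSeriesField p.SplittingField := Normal.of_isSplittingField p
  have hg : IsGalois ConvergentSeriesField p.SplittingField := ⟨⟩
  obtain ⟨w, hw⟩ := IsDiscreteValuationRing.exists_addValuation_extension ConvergentSeries
    ConvergentSeriesField p.SplittingField ConvergentSeries.irreducible_z
  refine ⟨p.SplittingField, inferInstance, inferInstance, inferInstance, hg, w, fun a => ?_, ?_⟩
  · by_cases ha : a = 0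
    · simp [ha, WithTop.map]
      rfl
    obtain ⟨n, u, h, hn⟩ := ConvergentSeries.exists_eq_z_pow_mul ha
    rw [hn, ← IsScalarTower.algebraMap_apply ConvergentSeries ConvergentSeriesField, h, hw]
    rfl
  · have h := Polynomial.SplittingField.splits p
    rwa [Polynomial.map_map] at h

/-! ### Newton regions and their supporting lines -/

/-- The weights `i + ρ * j` of the points `(i, j) ∈ S`. -/
def weights (S : Set (ℕ × ℕ)) (ρ : ℚ) : Set ℚ := (fun A : ℕ × ℕ => (A.1 + ρ * A.2 : ℚ)) '' S

theorem mem_newtonRegion {S : Set (ℕ × ℕ)} {A : ℕ × ℕ} (hA : A ∈ S) :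
    ((A.1 : ℝ), (A.2 : ℝ)) ∈ newtonRegion S :=
  subset_convexHull ℝ _ ⟨A, hA, 0, by simp⟩

/-- The hull of `ℕ²` is the real quadrant, and hulls commute with sums; so real translations are
absorbed, not only integral ones. -/
theorem add_mem_newtonRegion {S : Set (ℕ × ℕ)} {p d : ℝ × ℝ}
    (hp : p ∈ convexHull ℝ ((fun A : ℕ × ℕ => ((A.1 : ℝ), (A.2 : ℝ))) '' S)) (hd : 0 ≤ d) :
    p + d ∈ newtonRegion S := by
  have hray : ∀ x : ℝ, 0 ≤ x → x ∈ convexHull ℝ (Set.range (Nat.cast : ℕ → ℝ)) := fun x hx => by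
    refine segment_subset_convexHull (x := (0 : ℝ)) (y := (⌈x⌉₊ : ℝ))
      (Set.mem_range.2 ⟨0, by simp⟩) (Set.mem_range_self _) ?_
    rw [segment_eq_Icc (by positivity)]
    exact ⟨hx, Nat.le_ceil x⟩
  have hd' := mk_mem_convexHull_prod (hray d.1 hd.1) (hray d.2 hd.2)
  have h : p + d ∈ convexHull ℝ ((fun A : ℕ × ℕ => ((A.1 : ℝ), (A.2 : ℝ))) '' S +
      Set.range (Nat.cast : ℕ → ℝ) ×ˢ Set.range (Nat.cast : ℕ → ℝ)) := by
    rw [convexHull_add]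
    exact Set.add_mem_add hp hd'
  refine convexHull_mono ?_ h
  rintro _ ⟨_, ⟨A, hA, rfl⟩, ⟨x, y⟩, ⟨⟨m, rfl⟩, ⟨n, rfl⟩⟩, rfl⟩
  exact ⟨A, hA, (m, n), by simp⟩

/-- A support that meets both axes is dominated by a finite part of it. -/
theorem exists_finite_dominating {S : Set (ℕ × ℕ)} {m n : ℕ} (hm : (m, 0) ∈ S)
    (hn : (0, n) ∈ S) : ∃ T ⊆ S, T.Finite ∧ ∀ A ∈ S, ∃ B ∈ T, B ≤ A := by
  refine ⟨S ∩ Set.Iic (m, n), Set.inter_subset_left, (Set.finite_Iic _).inter_of_right S, ?_⟩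
  rintro ⟨i, j⟩ hA
  by_cases hi : m ≤ i
  · exact ⟨(m, 0), ⟨hm, ⟨le_rfl, Nat.zero_le _⟩⟩, ⟨hi, Nat.zero_le _⟩⟩
  by_cases hj : n ≤ j
  · exact ⟨(0, n), ⟨hn, ⟨Nat.zero_le _, le_rfl⟩⟩, ⟨Nat.zero_le _, hj⟩⟩
  exact ⟨(i, j), ⟨hA, ⟨(not_le.1 hi).le, (not_le.1 hj).le⟩⟩, le_rfl⟩

/-- A point of the quadrant that no line of negative rational slope separates from `S` lies in the
region of `S`. -/
theorem mem_newtonRegion_of_forall_weight {S : Set (ℕ × ℕ)} {m n : ℕ} (hm : (m, 0) ∈ S)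
    (hn : (0, n) ∈ S) {q : ℝ × ℝ} (hq : 0 ≤ q)
    (h : ∀ ρ : ℚ, 0 < ρ → ∃ A ∈ S, (A.1 + ρ * A.2 : ℝ) ≤ q.1 + ρ * q.2) :
    q ∈ newtonRegion S := by
  obtain ⟨T, hTS, hTf, hdom⟩ := exists_finite_dominating hm hn
  set C := convexHull ℝ ((fun A : ℕ × ℕ => ((A.1 : ℝ), (A.2 : ℝ))) '' T) with hC
  -- If the compact hull `C` meets the quadrant below `q`, then `q` is a point of `C` plus a
  -- nonnegative vector. Otherwise a line separates the two.
  by_cases hdisj : Disjoint C (Set.Iic q)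
  · exfalso
    obtain ⟨f, u, v, hfu, huv, hfv⟩ := geometric_hahn_banach_compact_closed
      (convex_convexHull ℝ _) ((hTf.image _).isCompact_convexHull (𝕜 := ℝ))
      (convex_Iic q) isClosed_Iic hdisj
    have hf : ∀ p : ℝ × ℝ, f p = p.1 * f (1, 0) + p.2 * f (0, 1) := fun p => by
      rw [← smul_eq_mul, ← smul_eq_mul, ← map_smul, ← map_smul, ← map_add]
      simp
    set α := f (1, 0) with hα
    set β := f (0, 1) with hβ
    have hqv : v < f q := hfv q Set.self_mem_Iic
    -- A functional bounded below on `Set.Iic q` has nonpositive coefficients: otherwise moving left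
    -- by `(f q - v) / α` would reach the value `v`.
    have hα0 : α ≤ 0 := by
      by_contra! hpos
      have h1 := hfv (q.1 - (f q - v) / α, q.2) ⟨sub_le_self _ (by
        have : 0 < f q - v := by linarith
        positivity), le_rfl⟩
      rw [hf, hf q] at h1
      simp only at h1
      have : (q.1 * α + q.2 * β - v) / α * α = q.1 * α + q.2 * β - v := by field_simp
      nlinarith
    have hβ0 : β ≤ 0 := by
      by_contra! hpos
      have h1 := hfv (q.1, q.2 - (f q - v) / β) ⟨le_rfl, sub_le_self _ (by
        have : 0 < f q - v := by linarith
        positivity)⟩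
      rw [hf, hf q] at h1
      simp only at h1
      have : (q.1 * α + q.2 * β - v) / β * β = q.1 * α + q.2 * β - v := by field_simp
      nlinarith
    have hq1 : 0 ≤ q.1 := hq.1
    have hq2 : 0 ≤ q.2 := hq.2
    -- The separating line may be axis-parallel or of irrational slope. Tilting it by `ε` leaves
    -- room for a rational `ρ`, and the error `ε * (q.1 + q.2)` at `q` stays below the gap `v - u`.
    set ε := (v - u) / (q.1 + q.2 + 1) with hε
    have hε0 : 0 < ε := div_pos (by linarith) (by linarith)
    have hεq : ε * (q.1 + q.2 + 1) = v - u := by rw [hε]; field_simp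
    have ha : 0 < -α + ε := by linarith
    obtain ⟨ρ, hρ1, hρ2⟩ := exists_rat_btwn (show -β / (-α + ε) < (-β + ε) / (-α + ε) by
      gcongr; linarith)
    rw [div_lt_iff₀ ha] at hρ1
    rw [lt_div_iff₀ ha] at hρ2
    have hρ0 : (0 : ℝ) < ρ := by
      by_contra! hneg
      nlinarith
    obtain ⟨A, hA, hAq⟩ := h ρ (by exact_mod_cast hρ0)
    obtain ⟨B, hB, hB1, hB2⟩ := hdom A hA
    have hB1' : (B.1 : ℝ) ≤ A.1 := by exact_mod_cast hB1
    have hB2' : (B.2 : ℝ) ≤ A.2 := by exact_mod_cast hB2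
    have hBu := hfu _ (subset_convexHull ℝ _ (Set.mem_image_of_mem _ hB))
    rw [hf] at hBu hqv
    simp only at hBu
    have hB10 : (0 : ℝ) ≤ B.1 := Nat.cast_nonneg _
    have hB20 : (0 : ℝ) ≤ B.2 := Nat.cast_nonneg _
    have h1 : (-α + ε) * (B.1 + ρ * B.2) ≤ (-α + ε) * (q.1 + ρ * q.2) := by
      refine mul_le_mul_of_nonneg_left (le_trans ?_ hAq) ha.le
      gcongr
    have h2 : -α * B.1 + -β * B.2 ≤ (-α + ε) * (B.1 + ρ * B.2) := by
      have e1 : -β * B.2 ≤ ρ * (-α + ε) * B.2 := by gcongr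
      nlinarith [mul_nonneg hε0.le hB10]
    have h3 : (-α + ε) * (q.1 + ρ * q.2) ≤ -α * q.1 + -β * q.2 + ε * (q.1 + q.2) := by
      have e1 : ρ * (-α + ε) * q.2 ≤ (-β + ε) * q.2 := by gcongr
      nlinarith
    nlinarith
  · obtain ⟨p, hp, hpq⟩ := Set.not_disjoint_iff.1 hdisj
    have h1 := add_mem_newtonRegion
      (convexHull_mono (Set.image_mono hTS) hp) (sub_nonneg.2 (Set.mem_Iic.1 hpq))
    rwa [add_sub_cancel] at h1

theorem newtonRegion_subset {S T : Set (ℕ × ℕ)} {m n : ℕ} (hm : (m, 0) ∈ S) (hn : (0, n) ∈ S)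
    (h : ∀ ρ : ℚ, 0 < ρ → ∃ μ, IsLeast (weights S ρ) μ ∧ IsLeast (weights T ρ) μ) :
    newtonRegion T ⊆ newtonRegion S := by
  refine convexHull_min ?_ (convex_convexHull ℝ _)
  rintro _ ⟨A, hA, B, rfl⟩
  refine mem_newtonRegion_of_forall_weight hm hn ⟨by positivity, by positivity⟩ fun ρ hρ => ?_
  obtain ⟨μ, ⟨⟨D, hD, hDμ⟩, -⟩, -, hμ⟩ := h ρ hρ
  refine ⟨D, hD, ?_⟩
  have h1 : μ ≤ (A.1 + ρ * A.2 : ℚ) := hμ ⟨A, hA, rfl⟩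
  have hDμ' : (D.1 + ρ * D.2 : ℚ) = μ := hDμ
  rw [← hDμ'] at h1
  have h2 : (D.1 + ρ * D.2 : ℝ) ≤ A.1 + ρ * A.2 := by exact_mod_cast h1
  have hρ' : (0 : ℝ) < ρ := by exact_mod_cast hρ
  have h3 : (A.1 + ρ * A.2 : ℝ) ≤ (A.1 + B.1 : ℕ) + ρ * (A.2 + B.2 : ℕ) := by
    push_cast
    gcongr <;> simp
  exact h2.trans h3

/-- The region of a support that meets both axes is determined by its supporting lines. -/
theorem newtonRegion_eq_of_weights {S T : Set (ℕ × ℕ)} (hS : (∃ m, (m, 0) ∈ S) ∧ ∃ n, (0, n) ∈ S)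
    (hT : (∃ m, (m, 0) ∈ T) ∧ ∃ n, (0, n) ∈ T)
    (h : ∀ ρ : ℚ, 0 < ρ → ∃ μ, IsLeast (weights S ρ) μ ∧ IsLeast (weights T ρ) μ) :
    newtonRegion S = newtonRegion T := by
  obtain ⟨⟨m, hm⟩, n, hn⟩ := hS
  obtain ⟨⟨m', hm'⟩, n', hn'⟩ := hT
  exact (newtonRegion_subset hm' hn' fun ρ hρ => (h ρ hρ).imp fun _ => And.symm).antisymm
    (newtonRegion_subset hm hn h)

theorem le_of_mem_newtonRegion {S : Set (ℕ × ℕ)} {ρ μ : ℚ} (hρ : 0 ≤ ρ)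
    (hμ : IsLeast (weights S ρ) μ) {p : ℝ × ℝ} (hp : p ∈ newtonRegion S) :
    (μ : ℝ) ≤ p.1 + ρ * p.2 := by
  have hconv : Convex ℝ {p : ℝ × ℝ | (μ : ℝ) ≤ p.1 + ρ * p.2} :=
    convex_halfSpace_ge (f := fun p : ℝ × ℝ => p.1 + ρ * p.2)
      ⟨fun x y => by simp; ring, fun c x => by simp; ring⟩ _
  refine convexHull_min ?_ hconv hp
  rintro _ ⟨A, hA, B, rfl⟩
  have h1 : μ ≤ (A.1 + ρ * A.2 : ℚ) := hμ.2 ⟨A, hA, rfl⟩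
  have h2 : (μ : ℝ) ≤ A.1 + ρ * A.2 := by exact_mod_cast h1
  have hρ' : (0 : ℝ) ≤ ρ := by exact_mod_cast hρ
  refine h2.trans ?_
  push_cast
  gcongr <;> simp

theorem weights_le_of_newtonRegion_eq {S T : Set (ℕ × ℕ)} (h : newtonRegion S = newtonRegion T)
    {ρ μ ν : ℚ} (hρ : 0 ≤ ρ) (hμ : IsLeast (weights S ρ) μ) (hν : IsLeast (weights T ρ) ν) :
    μ ≤ ν := by
  obtain ⟨A, hA, hAν⟩ := hν.1
  have h1 := le_of_mem_newtonRegion hρ hμ (h ▸ mem_newtonRegion hA)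
  have hAν' : (A.1 + ρ * A.2 : ℚ) = ν := hAν
  rw [← hAν']
  simp only at h1
  exact_mod_cast h1

theorem weights_eq_of_newtonRegion_eq {S T : Set (ℕ × ℕ)} (h : newtonRegion S = newtonRegion T)
    {ρ μ ν : ℚ} (hρ : 0 ≤ ρ) (hμ : IsLeast (weights S ρ) μ) (hν : IsLeast (weights T ρ) ν) :
    μ = ν :=
  (weights_le_of_newtonRegion_eq h hρ hμ hν).antisymm
    (weights_le_of_newtonRegion_eq h.symm hρ hν hμ)

theorem isLeast_weights_add {S T : Set (ℕ × ℕ)} {ρ μ ν : ℚ} (hμ : IsLeast (weights S ρ) μ)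
    (hν : IsLeast (weights T ρ) ν) : IsLeast (weights (S + T) ρ) (μ + ν) := by
  constructor
  · obtain ⟨A, hA, rfl⟩ := hμ.1
    obtain ⟨B, hB, rfl⟩ := hν.1
    refine ⟨A + B, Set.add_mem_add hA hB, ?_⟩
    simp only [Prod.fst_add, Prod.snd_add]
    push_cast
    ring
  · rintro _ ⟨_, ⟨A, hA, B, hB, rfl⟩, rfl⟩
    refine (add_le_add (hμ.2 ⟨A, hA, rfl⟩) (hν.2 ⟨B, hB, rfl⟩)).trans (le_of_eq ?_)
    simp only [Prod.fst_add, Prod.snd_add]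
    push_cast
    ring

/-- If `S` missed the axis, the half-plane `1 ≤ p.1` would contain the region. -/
theorem exists_mem_of_zero_fst_mem {S : Set (ℕ × ℕ)} {y : ℝ}
    (h : ((0 : ℝ), y) ∈ newtonRegion S) : ∃ n, (0, n) ∈ S := by
  by_contra! hS
  have hsub : newtonRegion S ⊆ {p : ℝ × ℝ | (1 : ℝ) ≤ p.1} := by
    refine convexHull_min ?_ (convex_halfSpace_ge (f := fun p : ℝ × ℝ => p.1)
      ⟨fun _ _ => rfl, fun _ _ => rfl⟩ _)
    rintro _ ⟨⟨i, j⟩, hA, B, rfl⟩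
    have hi : i ≠ 0 := by rintro rfl; exact hS j hA
    have : 1 ≤ i + B.1 := by omega
    change (1 : ℝ) ≤ ((i + B.1 : ℕ) : ℝ)
    exact_mod_cast this
  have := hsub h
  norm_num at this

theorem exists_mem_of_zero_snd_mem {S : Set (ℕ × ℕ)} {x : ℝ}
    (h : (x, (0 : ℝ)) ∈ newtonRegion S) : ∃ m, (m, 0) ∈ S := by
  by_contra! hS
  have hsub : newtonRegion S ⊆ {p : ℝ × ℝ | (1 : ℝ) ≤ p.2} := by
    refine convexHull_min ?_ (convex_halfSpace_ge (f := fun p : ℝ × ℝ => p.2)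
      ⟨fun _ _ => rfl, fun _ _ => rfl⟩ _)
    rintro _ ⟨⟨i, j⟩, hA, B, rfl⟩
    have hj : j ≠ 0 := by rintro rfl; exact hS i hA
    have : 1 ≤ j + B.2 := by omega
    change (1 : ℝ) ≤ ((j + B.2 : ℕ) : ℝ)
    exact_mod_cast this
  have := hsub h
  norm_num at this

/-! ### The weight of a polynomial and the valuations of its roots -/

section Weight

variable {L : Type*} [Field L]

/-- `μ` is the least of the numbers `w (g_j) + ρ * j`, for the coefficients `g_j` of `g`. -/
def HasWeight (w : AddValuation L (WithTop ℚ)) (ρ : ℚ) (g : Polynomial L) (μ : ℚ) : Prop :=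
  IsLeast (Set.range fun j : ℕ => w (g.coeff j) + ((ρ * j : ℚ) : WithTop ℚ)) (μ : WithTop ℚ)

theorem hasWeight_one (w : AddValuation L (WithTop ℚ)) (ρ : ℚ) :
    HasWeight w ρ 1 0 := by
  refine ⟨⟨0, by simp⟩, ?_⟩
  rintro _ ⟨j, rfl⟩
  rcases j with _ | j
  · simp
  · simp [Polynomial.coeff_one]

/-- Coefficients vanish beyond the degree, so the minimum cannot be attained at arbitrarily large
indices. The strict inequality at `j + 1` rules out cancellation in the next lemma, even when `ρ =
a`. -/
theorem HasWeight.exists_last {w : AddValuation L (WithTop ℚ)} {ρ : ℚ} {g : Polynomial L} {μ : ℚ}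
    (h : HasWeight w ρ g μ) : ∃ j : ℕ, w (g.coeff j) + ((ρ * j : ℚ) : WithTop ℚ) = μ ∧
      (μ : WithTop ℚ) < w (g.coeff (j + 1)) + ((ρ * (j + 1 : ℕ) : ℚ) : WithTop ℚ) := by
  classical
  by_contra! hcon
  have hall : ∀ k : ℕ, ∃ j ≥ k, w (g.coeff j) + ((ρ * j : ℚ) : WithTop ℚ) = μ := by
    intro k
    induction k with
    | zero => exact h.1.imp fun j hj => ⟨Nat.zero_le _, hj⟩
    | succ k ih =>
      obtain ⟨j, hjk, hj⟩ := ih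
      exact ⟨j + 1, by omega, le_antisymm (hcon j hj) (h.2 ⟨j + 1, rfl⟩)⟩
  obtain ⟨j, hjk, hj⟩ := hall (g.natDegree + 1)
  rw [Polynomial.coeff_eq_zero_of_natDegree_lt (by omega), AddValuation.map_zero, top_add] at hj
  exact WithTop.top_ne_coe hj

/-- Each new coefficient is `g_j - α * g_(j+1)`, whose two terms weigh at least `ρ + μ` and `a + μ`.
The bound is attained: for `ρ ≤ a` just after an index from `exists_last`, for `a < ρ` at any
minimizing index, since there one term strictly dominates. -/
theorem HasWeight.X_sub_C_mul {w : AddValuation L (WithTop ℚ)} {ρ : ℚ} {g : Polynomial L} {μ : ℚ}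
    (h : HasWeight w ρ g μ) {α : L} {a : ℚ} (ha : w α = (a : WithTop ℚ)) :
    HasWeight w ρ ((Polynomial.X - Polynomial.C α) * g) (min ρ a + μ) := by
  have hle : ∀ j, (μ : WithTop ℚ) ≤ w (g.coeff j) + ((ρ * j : ℚ) : WithTop ℚ) :=
    fun j => h.2 ⟨j, rfl⟩
  have hfirst : ∀ j : ℕ, w (g.coeff j) + ((ρ * (j + 1 : ℕ) : ℚ) : WithTop ℚ) =
      (ρ : WithTop ℚ) + (w (g.coeff j) + ((ρ * j : ℚ) : WithTop ℚ)) := fun j => by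
    have : ((ρ * (j + 1 : ℕ) : ℚ) : WithTop ℚ) = (ρ : WithTop ℚ) + ((ρ * j : ℚ) : WithTop ℚ) := by
      rw [← WithTop.coe_add]; congr 1; push_cast; ring
    rw [this, add_left_comm]
  have hsecond : ∀ j : ℕ, w (α * g.coeff j) + ((ρ * j : ℚ) : WithTop ℚ) =
      (a : WithTop ℚ) + (w (g.coeff j) + ((ρ * j : ℚ) : WithTop ℚ)) := fun j => by
    rw [AddValuation.map_mul, ha, add_assoc]
  have hcoeff : ∀ j : ℕ, ((Polynomial.X - Polynomial.C α) * g).coeff (j + 1) =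
      g.coeff j - α * g.coeff (j + 1) := fun j => by
    rw [sub_mul, Polynomial.coeff_sub, Polynomial.coeff_X_mul, Polynomial.coeff_C_mul]
  have hcoeff0 : ((Polynomial.X - Polynomial.C α) * g).coeff 0 = -(α * g.coeff 0) := by
    simp [sub_mul]
  have hmin1 : ((min ρ a + μ : ℚ) : WithTop ℚ) ≤ (ρ : WithTop ℚ) + (μ : WithTop ℚ) := by
    rw [← WithTop.coe_add]
    exact WithTop.coe_le_coe.2 (by gcongr; exact min_le_left _ _)
  have hmin2 : ((min ρ a + μ : ℚ) : WithTop ℚ) ≤ (a : WithTop ℚ) + (μ : WithTop ℚ) := by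
    rw [← WithTop.coe_add]
    exact WithTop.coe_le_coe.2 (by gcongr; exact min_le_right _ _)
  constructor
  · by_cases hρa : ρ ≤ a
    · obtain ⟨j, hj, hj'⟩ := h.exists_last
      refine ⟨j + 1, ?_⟩
      have h1 : w (g.coeff j) + ((ρ * (j + 1 : ℕ) : ℚ) : WithTop ℚ) = ((ρ + μ : ℚ) : WithTop ℚ) := by
        rw [hfirst, hj, WithTop.coe_add]
      have h2 : ((ρ + μ : ℚ) : WithTop ℚ) <
          w (α * g.coeff (j + 1)) + ((ρ * (j + 1 : ℕ) : ℚ) : WithTop ℚ) := by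
        rw [hsecond, WithTop.coe_add]
        exact (add_le_add_left (WithTop.coe_le_coe.2 hρa) _).trans_lt
          (WithTop.add_lt_add_left WithTop.coe_ne_top hj')
      have h3 : w (g.coeff j) < w (α * g.coeff (j + 1)) := by
        rw [← h1] at h2
        exact lt_of_add_lt_add_right h2
      beta_reduce
      rw [hcoeff, AddValuation.map_sub_eq_of_lt_left _ h3, h1, min_eq_left hρa]
    · have hρa' := not_le.1 hρa
      obtain ⟨j, hj⟩ := h.1
      beta_reduce at hj
      refine ⟨j, ?_⟩
      have h1 : w (α * g.coeff j) + ((ρ * j : ℚ) : WithTop ℚ) = ((a + μ : ℚ) : WithTop ℚ) := by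
        rw [hsecond, hj, WithTop.coe_add]
      beta_reduce
      rw [min_eq_right hρa'.le, ← h1]
      rcases j with _ | j
      · rw [hcoeff0, AddValuation.map_neg]
      · have h2 : ((a + μ : ℚ) : WithTop ℚ) <
            w (g.coeff j) + ((ρ * (j + 1 : ℕ) : ℚ) : WithTop ℚ) := by
          rw [hfirst]
          refine lt_of_lt_of_le ?_ (add_le_add_right (hle j) _)
          rw [← WithTop.coe_add]
          exact WithTop.coe_lt_coe.2 (by linarith)
        have h3 : w (α * g.coeff (j + 1)) < w (g.coeff j) := by
          rw [← h1] at h2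
          exact lt_of_add_lt_add_right h2
        rw [hcoeff, AddValuation.map_sub_eq_of_lt_right _ h3]
  · rintro _ ⟨j, rfl⟩
    rcases j with _ | j
    · beta_reduce
      rw [hcoeff0, AddValuation.map_neg, hsecond]
      exact hmin2.trans (add_le_add_right (hle 0) _)
    · beta_reduce
      rw [hcoeff]
      rcases min_le_iff.1 (AddValuation.map_sub w (g.coeff j) (α * g.coeff (j + 1))) with h1 | h1
      · refine le_trans ?_ (add_le_add_left h1 _)
        rw [hfirst]
        exact hmin1.trans (add_le_add_right (hle j) _)
      · refine le_trans ?_ (add_le_add_left h1 _)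
        rw [hsecond]
        exact hmin2.trans (add_le_add_right (hle _) _)

theorem hasWeight_prod_X_sub_C (w : AddValuation L (WithTop ℚ)) (ρ : ℚ) (s : Multiset L)
    (hs : ∀ α ∈ s, α ≠ 0) :
    HasWeight w ρ (s.map fun α => Polynomial.X - Polynomial.C α).prod
      ((s.map fun α => (w α).untopD 0).map (min ρ)).sum := by
  induction s using Multiset.induction_on with
  | empty => simpa using hasWeight_one w ρ
  | cons α s ih =>
    rw [Multiset.map_cons, Multiset.prod_cons, Multiset.map_cons, Multiset.map_cons,
      Multiset.sum_cons]
    refine (ih fun β hβ => hs β (Multiset.mem_cons_of_mem hβ)).X_sub_C_mul ?_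
    have h : w α ≠ ⊤ := fun h => hs α (Multiset.mem_cons_self _ _) (w.top_iff.1 h)
    obtain ⟨a, ha⟩ := WithTop.ne_top_iff_exists.1 h
    rw [← ha]
    rfl

end Weight

/-! ### Multisets of rational numbers -/

/-- All summands are nonpositive, so each must vanish. -/
theorem nonneg_of_sum_map_min_nonneg {M : Multiset ℚ} (h : 0 ≤ (M.map (min 0)).sum) :
    ∀ a ∈ M, 0 ≤ a := by
  induction M using Multiset.induction_on with
  | empty => simp
  | cons b M ih =>
    rw [Multiset.map_cons, Multiset.sum_cons] at h
    have h1 : (M.map (min 0)).sum ≤ 0 := by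
      have : ∀ x ∈ M.map (min (0 : ℚ)), x ≤ 0 := fun x hx => by
        obtain ⟨a, ha, rfl⟩ := Multiset.mem_map.1 hx
        exact min_le_left _ _
      simpa using Multiset.sum_le_card_nsmul _ 0 this
    have h2 : min 0 b ≤ 0 := min_le_left _ _
    intro a ha
    rcases Multiset.mem_cons.1 ha with rfl | ha
    · exact min_eq_left_iff.1 (by linarith)
    · exact ih (by linarith) a ha

/-- The second difference of `∑ min ρ a` at `ρ` counts the `a` that are equal to `ρ`. -/
theorem sum_map_min_second_difference {M : Multiset ℚ} {ρ ε : ℚ} (hε : 0 ≤ ε)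
    (h : ∀ a ∈ M, a ≠ ρ → ε ≤ |a - ρ|) :
    (M.map (min (ρ + ε))).sum + (M.map (min (ρ - ε))).sum + ε * M.count ρ =
      2 * (M.map (min ρ)).sum := by
  induction M using Multiset.induction_on with
  | empty => simp
  | cons b M ih =>
    have ih' := ih fun a ha => h a (Multiset.mem_cons_of_mem ha)
    simp only [Multiset.map_cons, Multiset.sum_cons]
    -- As a function of its first argument, `min · b` is affine on `[ρ - ε, ρ + ε]` unless its kink
    -- `b` is `ρ` itself, where the defect is `ε`.
    by_cases hb : b = ρ
    · subst hb
      rw [Multiset.count_cons_self, min_eq_right (by linarith : b ≤ b + ε),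
        min_eq_left (by linarith : b - ε ≤ b), min_self]
      push_cast
      linarith
    · rw [Multiset.count_cons_of_ne (Ne.symm hb)]
      have hb' := h b (Multiset.mem_cons_self _ _) hb
      rcases le_abs.1 hb' with h1 | h1
      · rw [min_eq_left (by linarith : ρ + ε ≤ b), min_eq_left (by linarith : ρ - ε ≤ b),
          min_eq_left (by linarith : ρ ≤ b)]
        linarith
      · rw [min_eq_right (by linarith : b ≤ ρ + ε), min_eq_right (by linarith : b ≤ ρ - ε),
          min_eq_right (by linarith : b ≤ ρ)]
        linarith

theorem exists_pos_le_abs_sub (M : Multiset ℚ) (ρ : ℚ) {δ : ℚ} (hδ : 0 < δ) :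
    ∃ ε, 0 < ε ∧ ε ≤ δ ∧ ∀ a ∈ M, a ≠ ρ → ε ≤ |a - ρ| := by
  induction M using Multiset.induction_on with
  | empty => exact ⟨δ, hδ, le_rfl, by simp⟩
  | cons b M ih =>
    obtain ⟨ε, hε, hεδ, h⟩ := ih
    by_cases hb : b = ρ
    · refine ⟨ε, hε, hεδ, fun a ha hne => ?_⟩
      rcases Multiset.mem_cons.1 ha with rfl | ha
      · exact absurd hb hne
      · exact h a ha hne
    · refine ⟨min ε |b - ρ|, lt_min hε (abs_pos.2 (sub_ne_zero.2 hb)),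
        (min_le_left _ _).trans hεδ, fun a ha hne => ?_⟩
      rcases Multiset.mem_cons.1 ha with rfl | ha
      · exact min_le_right _ _
      · exact (min_le_left _ _).trans (h a ha hne)

theorem count_eq_of_sum_map_min_eq {M N : Multiset ℚ}
    (h : ∀ ρ : ℚ, 0 < ρ → (M.map (min ρ)).sum = (N.map (min ρ)).sum) {ρ : ℚ} (hρ : 0 < ρ) :
    M.count ρ = N.count ρ := by
  -- One `ε` serves both multisets; the bound `ρ / 2` keeps `ρ - ε` positive, where `h` applies.
  obtain ⟨ε, hε, hερ, hall⟩ := exists_pos_le_abs_sub (M + N) ρ (half_pos hρ)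
  have hM := sum_map_min_second_difference hε.le fun a ha =>
    hall a (Multiset.mem_add.2 (Or.inl ha))
  have hN := sum_map_min_second_difference hε.le fun a ha =>
    hall a (Multiset.mem_add.2 (Or.inr ha))
  rw [h _ hρ, h (ρ + ε) (by linarith), h (ρ - ε) (by linarith), ← hN, add_right_inj] at hM
  exact_mod_cast mul_left_cancel₀ hε.ne' hM

theorem filter_pos_eq_of_count_eq {M N : Multiset ℚ}
    (h : ∀ ρ : ℚ, 0 < ρ → M.count ρ = N.count ρ) :
    M.filter (0 < ·) = N.filter (0 < ·) := by
  ext ρ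
  simp only [Multiset.count_filter]
  split_ifs with hρ
  · exact h ρ hρ
  · rfl

theorem filter_not_pos_eq_replicate {M : Multiset ℚ} (hM : ∀ a ∈ M, 0 ≤ a) :
    M.filter (fun a => ¬ 0 < a) = Multiset.replicate (M.filter (fun a => ¬ 0 < a)).card 0 := by
  refine Multiset.eq_replicate_card.2 fun a ha => ?_
  rw [Multiset.mem_filter, not_lt] at ha
  exact le_antisymm ha.2 (hM a ha.1)

/-- Zero entries contribute `min ρ 0 = 0`, so their number is irrelevant. -/
theorem sum_map_min_eq_of_count_eq {M N : Multiset ℚ} (hM : ∀ a ∈ M, 0 ≤ a)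
    (hN : ∀ a ∈ N, 0 ≤ a) (h : ∀ ρ : ℚ, 0 < ρ → M.count ρ = N.count ρ) {ρ : ℚ} (hρ : 0 < ρ) :
    (M.map (min ρ)).sum = (N.map (min ρ)).sum := by
  rw [← Multiset.filter_add_not (0 < ·) M, ← Multiset.filter_add_not (0 < ·) N,
    filter_not_pos_eq_replicate hM, filter_not_pos_eq_replicate hN, filter_pos_eq_of_count_eq h]
  simp [min_eq_right hρ.le]

/-- The cardinality recovers the one missing datum, the multiplicity of `0`. -/
theorem eq_of_count_eq_of_card_eq {M N : Multiset ℚ} (hM : ∀ a ∈ M, 0 ≤ a)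
    (hN : ∀ a ∈ N, 0 ≤ a) (h : ∀ ρ : ℚ, 0 < ρ → M.count ρ = N.count ρ)
    (hcard : M.card = N.card) : M = N := by
  have h1 := filter_pos_eq_of_count_eq h
  rw [← Multiset.filter_add_not (0 < ·) M, ← Multiset.filter_add_not (0 < ·) N,
    Multiset.card_add, Multiset.card_add, h1, add_right_inj] at hcard
  rw [← Multiset.filter_add_not (0 < ·) M, ← Multiset.filter_add_not (0 < ·) N, h1,
    filter_not_pos_eq_replicate hM, filter_not_pos_eq_replicate hN, hcard]

/-! ### Roots and Newton polygons of elements of `U` -/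

/-- The support of `f`: the exponents of its monomials `z₁ ^ i * z₂ ^ j`. -/
def newtonSupport (f : Polynomial ConvergentSeries) : Set (ℕ × ℕ) :=
  {A | PowerSeries.coeff A.1 (f.coeff A.2 : ℂ⟦X⟧) ≠ 0}

theorem region_newtonPolygon (f : Polynomial ConvergentSeries) :
    (newtonPolygon f).region = newtonRegion (newtonSupport f) := rfl

theorem newtonSupport_meets_axes {f : Polynomial ConvergentSeries} (hf : f ∈ monicU) :
    (∃ m, (m, 0) ∈ newtonSupport f) ∧ ∃ n, (0, n) ∈ newtonSupport f := by
  constructor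
  · have h0 : f.coeff 0 ≠ 0 := fun h => hf.2 (Polynomial.X_dvd_iff.2 h)
    have h1 : (f.coeff 0 : ℂ⟦X⟧) ≠ 0 := fun h => h0 (Subtype.ext h)
    by_contra! h
    exact h1 (PowerSeries.ext fun m => not_not.1 (h m))
  · refine ⟨f.natDegree, ?_⟩
    simp [newtonSupport, hf.1.coeff_natDegree]

section Roots

variable {L : Type} [Field L] [Algebra ConvergentSeriesField L]

/-- The valuations of the roots of `f` in `L`. -/
noncomputable def rootValuations (w : AddValuation L (WithTop ℚ))
    (f : Polynomial ConvergentSeries) : Multiset ℚ :=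
  (overField L f).roots.map fun α => (w α).untopD 0

theorem injective_toField : Function.Injective ((algebraMap ConvergentSeriesField L).comp
    (algebraMap ConvergentSeries ConvergentSeriesField)) :=
  (algebraMap ConvergentSeriesField L).injective.comp (IsFractionRing.injective ConvergentSeries _)

theorem overField_monic {f : Polynomial ConvergentSeries} (hf : f ∈ monicU) :
    (overField L f).Monic := hf.1.map _

/-- This is where `z₂ ∤ f` enters; it ensures that the default `0` in `rootValuations` is never
used. -/
theorem ne_zero_of_mem_roots {f : Polynomial ConvergentSeries} (hf : f ∈ monicU) :
    ∀ α ∈ (overField L f).roots, α ≠ 0 := by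
  rintro α hα rfl
  have h := (Polynomial.mem_roots'.1 hα).2
  rw [Polynomial.IsRoot, ← Polynomial.coeff_zero_eq_eval_zero, overField, Polynomial.coeff_map,
    map_eq_zero_iff _ injective_toField] at h
  exact hf.2 (Polynomial.X_dvd_iff.2 h)

theorem rootCount_eq_count (w : AddValuation L (WithTop ℚ)) {f : Polynomial ConvergentSeries}
    (hf : f ∈ monicU) (ρ : ℚ) : rootCount w f ρ = (rootValuations w f).count ρ := by
  have h : (overField L f).roots.map w =
      (rootValuations w f).map fun a : ℚ => (a : WithTop ℚ) := by
    rw [rootValuations, Multiset.map_map]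
    refine Multiset.map_congr rfl fun α hα => ?_
    have h : w α ≠ ⊤ := fun h => ne_zero_of_mem_roots hf α hα (w.top_iff.1 h)
    obtain ⟨a, ha⟩ := WithTop.ne_top_iff_exists.1 h
    rw [Function.comp_apply, ← ha]
    rfl
  rw [rootCount, h, Multiset.count_map_eq_count' _ _ WithTop.coe_injective]

theorem card_rootValuations (w : AddValuation L (WithTop ℚ)) {f : Polynomial ConvergentSeries}
    (hf : f ∈ monicU) (hs : (overField L f).Splits) :
    (rootValuations w f).card = f.natDegree := by
  rw [rootValuations, Multiset.card_map, ← hs.natDegree_eq_card_roots, overField,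
    hf.1.natDegree_map]

theorem rootValuations_mul (w : AddValuation L (WithTop ℚ)) {f g : Polynomial ConvergentSeries}
    (hf : f ∈ monicU) (hg : g ∈ monicU) :
    rootValuations w (f * g) = rootValuations w f + rootValuations w g := by
  rw [rootValuations, overField, Polynomial.map_mul, Polynomial.roots_mul, Multiset.map_add]
  · rfl
  · exact mul_ne_zero (overField_monic hf).ne_zero (overField_monic hg).ne_zero

theorem splits_of_splits_mul {f g : Polynomial ConvergentSeries} (hf : f ∈ monicU)
    (hg : g ∈ monicU) (h : (overField L (f * g)).Splits) :
    (overField L f).Splits ∧ (overField L g).Splits := by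
  rw [overField, Polynomial.map_mul] at h
  have h0 := mul_ne_zero (overField_monic (L := L) hf).ne_zero (overField_monic hg).ne_zero
  exact ⟨h.of_dvd h0 (dvd_mul_right _ _), h.of_dvd h0 (dvd_mul_left _ _)⟩

theorem hasWeight_overField (w : AddValuation L (WithTop ℚ)) {f : Polynomial ConvergentSeries}
    (hf : f ∈ monicU) (hs : (overField L f).Splits) (ρ : ℚ) :
    HasWeight w ρ (overField L f) ((rootValuations w f).map (min ρ)).sum := by
  have h := hasWeight_prod_X_sub_C w ρ (overField L f).roots (ne_zero_of_mem_roots hf)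
  rwa [← hs.eq_prod_roots_of_monic (overField_monic hf)] at h

/-- For fixed `j`, the least `i` in the support is the order of `f_j`, which is the valuation of
that coefficient in `L`. So the support function of the polygon is the weight computed from the
roots. -/
theorem isLeast_weights_newtonSupport {w : AddValuation L (WithTop ℚ)} (hw : ExtendsAdic w)
    {f : Polynomial ConvergentSeries} (hf : f ∈ monicU) (hs : (overField L f).Splits) (ρ : ℚ) :
    IsLeast (weights (newtonSupport f) ρ) ((rootValuations w f).map (min ρ)).sum := by
  obtain ⟨⟨j, hj⟩, hle⟩ := hasWeight_overField w hf hs ρ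
  have hcoeff : ∀ j, w ((overField L f).coeff j) =
      WithTop.map (Nat.cast : ℕ → ℚ) (PowerSeries.order (f.coeff j : ℂ⟦X⟧)) := fun j => by
    rw [overField, Polynomial.coeff_map, RingHom.comp_apply]
    exact hw _
  have hle' : ∀ (i : ℕ) (j : ℕ), PowerSeries.order (f.coeff j : ℂ⟦X⟧) = i →
      ((rootValuations w f).map (min ρ)).sum ≤ i + ρ * j := fun i j hij => by
    have h : _ ≤ w ((overField L f).coeff j) + ((ρ * j : ℚ) : WithTop ℚ) := hle ⟨j, rfl⟩
    rw [hcoeff, hij] at h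
    exact WithTop.coe_le_coe.1 h
  constructor
  · beta_reduce at hj
    rw [hcoeff] at hj
    rcases h : PowerSeries.order (f.coeff j : ℂ⟦X⟧) with _ | i
    · rw [h] at hj
      exact absurd hj WithTop.top_ne_coe
    · rw [h] at hj
      refine ⟨(i, j), ?_, WithTop.coe_injective hj⟩
      exact (PowerSeries.order_eq_nat.1 h).1
  · rintro _ ⟨⟨i, j⟩, hij, rfl⟩
    have h1 : PowerSeries.order (f.coeff j : ℂ⟦X⟧) ≤ i := PowerSeries.order_le i hij
    obtain ⟨k, hk⟩ := ENat.ne_top_iff_exists.1 (ne_top_of_le_ne_top (ENat.natCast_ne_top i) h1)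
    refine (hle' k j hk.symm).trans ?_
    rw [← hk] at h1
    have h2 : (k : ℚ) ≤ i := by exact_mod_cast h1
    exact add_le_add_left h2 _

/-- At `ρ = 0` the weights are the exponents `i ≥ 0`, so the sum of `min 0 a` is nonnegative. -/
theorem rootValuations_nonneg {w : AddValuation L (WithTop ℚ)} (hw : ExtendsAdic w)
    {f : Polynomial ConvergentSeries} (hf : f ∈ monicU) (hs : (overField L f).Splits) :
    ∀ a ∈ rootValuations w f, 0 ≤ a := by
  refine nonneg_of_sum_map_min_nonneg ?_
  obtain ⟨A, -, hA⟩ := (isLeast_weights_newtonSupport hw hf hs 0).1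
  rw [← hA]
  simp

theorem count_rootValuations_eq_iff {w : AddValuation L (WithTop ℚ)} (hw : ExtendsAdic w)
    {f g : Polynomial ConvergentSeries} (hf : f ∈ monicU) (hg : g ∈ monicU)
    (hfs : (overField L f).Splits) (hgs : (overField L g).Splits) :
    (∀ ρ : ℚ, 0 < ρ → (rootValuations w f).count ρ = (rootValuations w g).count ρ) ↔
      newtonPolygon f = newtonPolygon g := by
  constructor
  · intro h
    ext1
    refine newtonRegion_eq_of_weights (newtonSupport_meets_axes hf) (newtonSupport_meets_axes hg)
      fun ρ hρ => ⟨_, isLeast_weights_newtonSupport hw hf hfs ρ, ?_⟩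
    rw [sum_map_min_eq_of_count_eq (rootValuations_nonneg hw hf hfs)
      (rootValuations_nonneg hw hg hgs) h hρ]
    exact isLeast_weights_newtonSupport hw hg hgs ρ
  · intro h ρ hρ
    refine count_eq_of_sum_map_min_eq (fun σ hσ => ?_) hρ
    exact weights_eq_of_newtonRegion_eq (congrArg NewtonPolygon.region h) hσ.le
      (isLeast_weights_newtonSupport hw hf hfs σ) (isLeast_weights_newtonSupport hw hg hgs σ)

end Roots

/-- The polygon does not depend on `L`, so one extension splitting `f * g` suffices; its existence
keeps the relation from being vacuous. -/
theorem posRootEquiv_iff {f g : Polynomial ConvergentSeries} (hf : f ∈ monicU) (hg : g ∈ monicU) :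
    PosRootEquiv f g ↔ newtonPolygon f = newtonPolygon g := by
  constructor
  · intro h
    obtain ⟨L, _, _, _, _, w, hw, hs⟩ := exists_splitting_extension (f * g)
    obtain ⟨hfs, hgs⟩ := splits_of_splits_mul hf hg hs
    refine (count_rootValuations_eq_iff hw hf hg hfs hgs).1 fun ρ hρ => ?_
    rw [← rootCount_eq_count w hf, ← rootCount_eq_count w hg]
    exact h ρ hρ L w hw hfs hgs
  · intro h ρ hρ L _ _ _ _ w hw hfs hgs
    rw [rootCount_eq_count w hf, rootCount_eq_count w hg]
    exact (count_rootValuations_eq_iff hw hf hg hfs hgs).2 h ρ hρ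

theorem rootEquiv_iff {f g : Polynomial ConvergentSeries} (hf : f ∈ monicU) (hg : g ∈ monicU) :
    RootEquiv f g ↔ newtonPolygon f = newtonPolygon g ∧ f.natDegree = g.natDegree := by
  constructor
  · intro h
    refine ⟨(posRootEquiv_iff hf hg).1 fun ρ _ => h ρ, ?_⟩
    obtain ⟨L, _, _, _, _, w, hw, hs⟩ := exists_splitting_extension (f * g)
    obtain ⟨hfs, hgs⟩ := splits_of_splits_mul hf hg hs
    rw [← card_rootValuations w hf hfs, ← card_rootValuations w hg hgs]
    congr 1
    ext ρ
    rw [← rootCount_eq_count w hf, ← rootCount_eq_count w hg]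
    exact h ρ L w hw hfs hgs
  · rintro ⟨h, hdeg⟩ ρ L _ _ _ _ w hw hfs hgs
    rw [rootCount_eq_count w hf, rootCount_eq_count w hg]
    congr 1
    refine eq_of_count_eq_of_card_eq (rootValuations_nonneg hw hf hfs)
      (rootValuations_nonneg hw hg hgs) ((count_rootValuations_eq_iff hw hf hg hfs hgs).2 h) ?_
    rw [card_rootValuations w hf hfs, card_rootValuations w hg hgs, hdeg]

/-- Root multisets add, hence so do support functions; cancellation among the monomials of `f * g`
need not be examined. -/
theorem newtonPolygon_mul {f g : Polynomial ConvergentSeries} (hf : f ∈ monicU)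
    (hg : g ∈ monicU) : newtonPolygon (f * g) = newtonPolygon f + newtonPolygon g := by
  obtain ⟨L, _, _, _, _, w, hw, hs⟩ := exists_splitting_extension (f * g)
  obtain ⟨hfs, hgs⟩ := splits_of_splits_mul hf hg hs
  ext1
  rw [NewtonPolygon.region_add, region_newtonPolygon, region_newtonPolygon, region_newtonPolygon,
    newtonRegion_add]
  obtain ⟨⟨m, hm⟩, n, hn⟩ := newtonSupport_meets_axes hf
  obtain ⟨⟨m', hm'⟩, n', hn'⟩ := newtonSupport_meets_axes hg
  refine newtonRegion_eq_of_weights (newtonSupport_meets_axes (monicU.mul_mem hf hg))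
    ⟨⟨m + m', _, hm, _, hm', by simp⟩, n + n', _, hn, _, hn', by simp⟩
    fun ρ hρ => ⟨_, isLeast_weights_newtonSupport hw (monicU.mul_mem hf hg) hs ρ, ?_⟩
  rw [rootValuations_mul w hf hg, Multiset.map_add, Multiset.sum_add]
  exact isLeast_weights_add (isLeast_weights_newtonSupport hw hf hfs ρ)
    (isLeast_weights_newtonSupport hw hg hgs ρ)

theorem newtonPolygon_one : newtonPolygon 1 = 0 := by
  ext1
  rw [region_newtonPolygon, NewtonPolygon.region_zero]
  congr 1
  ext ⟨i, j⟩
  rcases j with _ | j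
  · simp [newtonSupport, PowerSeries.coeff_one]
  · simp [newtonSupport, Polynomial.coeff_one]

theorem newtonPolygon_mem_NU {f : Polynomial ConvergentSeries} (hf : f ∈ monicU) :
    newtonPolygon f ∈ NewtonPolygon.NU := by
  obtain ⟨⟨m, hm⟩, n, hn⟩ := newtonSupport_meets_axes hf
  exact ⟨⟨m, by simpa [region_newtonPolygon] using mem_newtonRegion hm⟩, ⟨n, by simpa [region_newtonPolygon] using mem_newtonRegion hn⟩⟩

/-! ### Weierstrass polynomials -/

theorem one_le_fst_of_mem_newtonSupport {f : Polynomial ConvergentSeries} (hf : f ∈ weierstrassU)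
    {i j : ℕ} (h : (i, j) ∈ newtonSupport f) (hj : j ≠ f.natDegree) : 1 ≤ i := by
  by_contra hi
  obtain rfl : i = 0 := by omega
  refine h ?_
  have h1 := congrArg (fun p => Polynomial.coeff p j) hf.2
  simpa [atZero, Polynomial.coeff_X_pow, hj] using h1

/-- For such small `ρ` the vertex `(0, n)` on the `z₂`-axis is minimal: every other support point
has `i ≥ 1 ≥ ρ * n`. -/
theorem isLeast_weights_weierstrass {f : Polynomial ConvergentSeries} (hf : f ∈ weierstrassU)
    {ρ : ℚ} (hρ : 0 ≤ ρ) (h : ρ * f.natDegree ≤ 1) :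
    IsLeast (weights (newtonSupport f) ρ) (ρ * f.natDegree) := by
  constructor
  · refine ⟨(0, f.natDegree), ?_, by simp⟩
    simp [newtonSupport, hf.1.1.coeff_natDegree]
  · rintro _ ⟨⟨i, j⟩, hij, rfl⟩
    by_cases hj : j = f.natDegree
    · subst hj
      simp
    · have hi : (1 : ℚ) ≤ i := by exact_mod_cast one_le_fst_of_mem_newtonSupport hf hij hj
      have : 0 ≤ ρ * j := by positivity
      simp only
      linarith

theorem natDegree_eq_of_newtonPolygon_eq {f g : Polynomial ConvergentSeries}
    (hf : f ∈ weierstrassU) (hg : g ∈ weierstrassU) (h : newtonPolygon f = newtonPolygon g) :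
    f.natDegree = g.natDegree := by
  -- This `ρ` is small enough for both degrees at once.
  have hρ : (0 : ℚ) < (f.natDegree + g.natDegree + 1 : ℚ)⁻¹ := by positivity
  have h1 := weights_eq_of_newtonRegion_eq (congrArg NewtonPolygon.region h) hρ.le
    (isLeast_weights_weierstrass hf hρ.le ?_) (isLeast_weights_weierstrass hg hρ.le ?_)
  · exact_mod_cast mul_left_cancel₀ hρ.ne' h1
  all_goals
    rw [inv_mul_le_iff₀ (by positivity)]
    have h1 : (0 : ℚ) ≤ f.natDegree := Nat.cast_nonneg _
    have h2 : (0 : ℚ) ≤ g.natDegree := Nat.cast_nonneg _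
    linarith

/-- The witness is `z₂ ^ n + ∑ z₁ ^ m(j) * z₂ ^ j` over `j < n`, where `(0, n)` is the lowest point
of `S` on the axis and `m(j)` is the least abscissa in `S` at height at most `j`. -/
theorem exists_weierstrass_newtonPolygon_eq {N : NewtonPolygon} (hN : N ∈ NewtonPolygon.NU) :
    ∃ f ∈ weierstrassU, newtonPolygon f = N := by
  classical
  obtain ⟨S, hS⟩ := N.exists_support
  obtain ⟨⟨x, hx⟩, y, hy⟩ := hN
  rw [hS] at hx hy
  obtain ⟨m₀, hm₀⟩ := exists_mem_of_zero_snd_mem hx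
  have hex := exists_mem_of_zero_fst_mem hy
  set n := Nat.find hex with hn
  have hnS : (0, n) ∈ S := Nat.find_spec hex
  have hlow : ∀ j, ∃ i, ∃ k ≤ j, (i, k) ∈ S := fun j => ⟨m₀, 0, Nat.zero_le j, hm₀⟩
  set m : ℕ → ℕ := fun j => Nat.find (hlow j) with hm
  have hmS : ∀ j, ∃ k ≤ j, (m j, k) ∈ S := fun j => Nat.find_spec (hlow j)
  have hmle : ∀ {i k j : ℕ}, (i, k) ∈ S → k ≤ j → m j ≤ i := fun h hk =>
    Nat.find_min' (hlow _) ⟨_, hk, h⟩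
  -- A zero `m j` would give a point of `S` on the axis below `n`. This positivity makes `f` a
  -- Weierstrass polynomial.
  have hmpos : ∀ j < n, m j ≠ 0 := fun j hj h0 => by
    obtain ⟨k, hk, hkS⟩ := hmS j
    rw [h0] at hkS
    exact Nat.find_min hex (lt_of_le_of_lt hk hj) hkS
  let p : Polynomial ConvergentSeries :=
    ∑ j ∈ Finset.range n, Polynomial.monomial j (ConvergentSeries.z ^ m j)
  have hpc : ∀ j, p.coeff j = if j < n then ConvergentSeries.z ^ m j else 0 := fun j => by
    simp [p, Polynomial.finsetSum_coeff, Polynomial.coeff_monomial]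
  have hpdeg : p.degree < n := by
    rw [Polynomial.degree_lt_iff_coeff_zero]
    intro j hj
    rw [hpc, if_neg (by exact_mod_cast not_lt.2 hj)]
  set f : Polynomial ConvergentSeries := Polynomial.X ^ n + p with hf
  have hfm : f.Monic := Polynomial.monic_X_pow_add hpdeg
  have hfdeg : f.natDegree = n := Polynomial.natDegree_eq_of_degree_eq_some (by
    rw [hf, Polynomial.degree_add_eq_left_of_degree_lt, Polynomial.degree_X_pow]
    rwa [Polynomial.degree_X_pow])
  have hfc : ∀ j, f.coeff j =
      if j < n then ConvergentSeries.z ^ m j else if j = n then 1 else 0 := fun j => by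
    rw [hf, Polynomial.coeff_add, Polynomial.coeff_X_pow, hpc]
    split_ifs <;> first | omega | simp
  have hsupp : ∀ i j, (i, j) ∈ newtonSupport f ↔ (j < n ∧ i = m j) ∨ (j = n ∧ i = 0) := by
    intro i j
    simp only [newtonSupport, Set.mem_ofPred_eq, hfc]
    split_ifs with h1 h2
    · simp [ConvergentSeries.coe_z, PowerSeries.coeff_X_pow, h1, h1.ne]
    · simp [PowerSeries.coeff_one, h2]
    · simp [h1, h2]
  have hz : ConvergentSeries.z ≠ 0 := ConvergentSeries.irreducible_z.ne_zero
  have hX : ¬ Polynomial.X ∣ f := by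
    rw [Polynomial.X_dvd_iff, hfc]
    split_ifs with h1 h2
    · exact pow_ne_zero _ hz
    · exact one_ne_zero
    · omega
  refine ⟨f, ⟨⟨hfm, hX⟩, ?_⟩, ?_⟩
  · rw [hfdeg]
    ext j
    rw [atZero, Polynomial.coeff_map, hfc, Polynomial.coeff_X_pow]
    split_ifs with h1 h2 h2
    · omega
    · simp [ConvergentSeries.coe_z, hmpos j h1]
    · simp
    · simp
  · ext1
    rw [hS, region_newtonPolygon, newtonRegion, newtonRegion]
    -- Already the lattice shadows agree, before taking hulls.
    congr 1
    ext q
    constructor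
    · rintro ⟨⟨i, j⟩, hA, B, rfl⟩
      rcases (hsupp i j).1 hA with ⟨-, rfl⟩ | ⟨rfl, rfl⟩
      · obtain ⟨k, hk, hkS⟩ := hmS j
        exact ⟨_, hkS, (B.1, j - k + B.2), by
          simp only [← add_assoc, Nat.add_sub_cancel' hk]⟩
      · exact ⟨_, hnS, B, rfl⟩
    · rintro ⟨⟨i, j⟩, hA, B, rfl⟩
      by_cases hj : j < n
      · have hle := hmle hA (le_refl j)
        exact ⟨(m j, j), (hsupp _ _).2 (Or.inl ⟨hj, rfl⟩), (i - m j + B.1, B.2), by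
          simp only [← add_assoc, Nat.add_sub_cancel' hle]⟩
      · exact ⟨(0, n), (hsupp _ _).2 (Or.inr ⟨rfl, rfl⟩), (i + B.1, j - n + B.2), by
          simp only [← add_assoc, Nat.add_sub_cancel' (not_lt.1 hj), zero_add]⟩

/-! ### The monoid homomorphisms -/

/-- The homomorphism `f ↦ N(f)` from `U` to `NU`. -/
noncomputable def newtonHom : monicU →* Multiplicative NewtonPolygon.NU where
  toFun f := Multiplicative.ofAdd ⟨newtonPolygon f, newtonPolygon_mem_NU f.2⟩
  map_one' := congrArg Multiplicative.ofAdd (Subtype.ext newtonPolygon_one)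
  map_mul' f g := congrArg Multiplicative.ofAdd (Subtype.ext (newtonPolygon_mul f.2 g.2))

theorem newtonHom_eq_iff {f g : monicU} : newtonHom f = newtonHom g ↔
    newtonPolygon (f : Polynomial ConvergentSeries) = newtonPolygon g :=
  Multiplicative.toAdd.injective.eq_iff.symm.trans Subtype.ext_iff

/-- The degree in `z₂`, as a homomorphism on `U`. -/
noncomputable def degreeHom : monicU →* Multiplicative ℕ where
  toFun f := Multiplicative.ofAdd (f : Polynomial ConvergentSeries).natDegree
  map_one' := congrArg Multiplicative.ofAdd Polynomial.natDegree_one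
  map_mul' f g := congrArg Multiplicative.ofAdd (f.2.1.natDegree_mul g.2.1)

theorem weierstrassU_le_monicU : weierstrassU ≤ monicU := fun _ hf => hf.1

theorem newtonHom_comp_inclusion_surjective :
    Function.Surjective (newtonHom.comp (Submonoid.inclusion weierstrassU_le_monicU)) := by
  intro N
  obtain ⟨f, hf, h⟩ := exists_weierstrass_newtonPolygon_eq N.toAdd.2
  exact ⟨⟨f, hf⟩, congrArg Multiplicative.ofAdd (Subtype.ext h)⟩

theorem newtonHom_surjective : Function.Surjective newtonHom := fun N =>
  (newtonHom_comp_inclusion_surjective N).imp' _ fun _ h => h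

theorem mainTheorem10 :
    (∃ c : Con weierstrassU,
      (∀ f g : weierstrassU, c f g ↔ RootEquiv (f : Polynomial ConvergentSeries) g) ∧
      ∃ e : c.Quotient ≃* Multiplicative NewtonPolygon.NU,
        ∀ f : weierstrassU, ((e (f : c.Quotient)).toAdd : NewtonPolygon) = newtonPolygon f) ∧
    (∃ c : Con monicU,
      (∀ f g : monicU, c f g ↔ RootEquiv (f : Polynomial ConvergentSeries) g) ∧
      ∃ φ : c.Quotient →* Multiplicative NewtonPolygon.NU,
        (∀ f : monicU, ((φ (f : c.Quotient)).toAdd : NewtonPolygon) = newtonPolygon f) ∧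
        Function.Surjective φ) ∧
    (∃ c : Con monicU,
      (∀ f g : monicU, c f g ↔ PosRootEquiv (f : Polynomial ConvergentSeries) g) ∧
      ∃ e : c.Quotient ≃* Multiplicative NewtonPolygon.NU,
        ∀ f : monicU, ((e (f : c.Quotient)).toAdd : NewtonPolygon) = newtonPolygon f) := by
  -- Each relation is the kernel of a homomorphism, hence a congruence: the polygon for `∼` on `W`
  -- and for `∼₊` on `U`, the polygon together with the degree for `∼` on `U`.
  refine ⟨⟨Con.ker (newtonHom.comp (Submonoid.inclusion weierstrassU_le_monicU)), fun f g => ?_,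
    Con.quotientKerEquivOfSurjective _ newtonHom_comp_inclusion_surjective, fun f => rfl⟩,
    ⟨Con.ker (newtonHom.prod degreeHom), fun f g => ?_,
      Con.lift _ newtonHom fun f g h => (Prod.ext_iff.1 ((Con.ker_rel _).1 h)).1, fun f => rfl, ?_⟩,
    ⟨Con.ker newtonHom, fun f g => ?_,
      Con.quotientKerEquivOfSurjective _ newtonHom_surjective, fun f => rfl⟩⟩
  · rw [Con.ker_rel, rootEquiv_iff f.2.1 g.2.1]
    refine newtonHom_eq_iff.trans (iff_self_and.2 fun h => ?_)
    exact natDegree_eq_of_newtonPolygon_eq f.2 g.2 h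
  · rw [Con.ker_rel, rootEquiv_iff f.2 g.2, MonoidHom.prod_apply, MonoidHom.prod_apply,
      Prod.ext_iff]
    exact and_congr newtonHom_eq_iff Multiplicative.ofAdd.injective.eq_iff
  · exact Con.lift_surjective_of_surjective _ newtonHom_surjective
  · rw [Con.ker_rel, posRootEquiv_iff f.2 g.2]
    exact newtonHom_eq_iff
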